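/- Let $X$ be a collectionwise normal Hausdorff space (every discrete collection of subsets of $X$ has an open discrete expansion), let $E$ be a Banach space, and let $\Phi$ assign to each $x\in X$ a nonempty closed convex set $\Phi(x)\subset E$. Suppose $\Phi$ is lower semi-continuous (l.s.c.), i.e. $\{x\in X:\Phi(x)\cap U\neq\emptyset\}$ is open in $X$ for every open $U\subset E$. Let $A\subset X$ be a closed subset such that the restriction $\Phi{\upharpoonright}(X\setminus A)$ is proximal continuous: it is l.s.c. and there is a metric $d$ on $E$, inducing the norm topology of $E$, such that for every $\varepsilon>0$ each point $p\in X\setminus A$ has a neighbourhood $V$ in $X\setminus A$ with $$\Phi(x)\subset\{y\in E: d(y,z)<\varepsilon\text{ for some }z\in\Phi(p)\}\quad\text{for all }x\in V.$$ Then every continuous map $g:A\to E$ with $g(x)\in\Phi(x)$ for all $x\in A$ can be extended to a continuous map $f:X\to E$ with $f(x)\in\Phi(x)$ for all $x\in X$. -/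

import Mathlib

open Topology

/-- An indexed family of subsets is *discrete* if every point has a neighbourhood meeting at most
one member of the family (members being counted by their index). -/
def IsDiscreteFamily {X ι : Type*} [TopologicalSpace X] (s : ι → Set X) : Prop :=
  ∀ x : X, ∃ N ∈ 𝓝 x, {i : ι | (s i ∩ N).Nonempty}.Subsingleton

/-- Collectionwise normality (Bing): every discrete collection of subsets has an open discrete
expansion. The Hausdorff axiom is a separate hypothesis. -/
def CollectionwiseNormal (X : Type*) [TopologicalSpace X] : Prop :=
  ∀ 𝒟 : Set (Set X), IsDiscreteFamily (fun D : 𝒟 => (D : Set X)) →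
    ∃ U : 𝒟 → Set X, (∀ D : 𝒟, IsOpen (U D)) ∧ (∀ D : 𝒟, (D : Set X) ⊆ U D) ∧ IsDiscreteFamily U

/-- `ρ`-upper semi-continuity of a set-valued mapping into a metric space `(Y, ρ)`: for every
`ε > 0`, each point `p` has a neighbourhood on which `Φ x` lies in the open `ε`-neighbourhood
of `Φ p`. -/
def SetValuedMetricUSC {X Y : Type*} [TopologicalSpace X] [MetricSpace Y] (Φ : X → Set Y) : Prop :=
  ∀ ε : ℝ, 0 < ε → ∀ p : X, ∃ V ∈ 𝓝 p, ∀ x ∈ V, Φ x ⊆ Metric.thickening ε (Φ p)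

/-- Proximal continuity of a set-valued mapping into a (metrizable) space `Y`: it is l.s.c.
(that is, lower hemicontinuous), and it is `d`-u.s.c. for some metric `d` on `Y` that induces the
given topology of `Y`. -/
def ProximalContinuous {X Y : Type*} [TopologicalSpace X] [tY : TopologicalSpace Y]
    (Φ : X → Set Y) : Prop :=
  LowerHemicontinuous Φ ∧ ∃ d : MetricSpace Y,
    d.toPseudoMetricSpace.toUniformSpace.toTopologicalSpace = tY ∧
      @SetValuedMetricUSC X Y _ d Φ

/-!
For `d`-Lipschitz `v : E → ℝ≥0∞`, proximal continuity of `Φ` makes `y ↦ ⨆ z ∈ Φ y, v z` continuous.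
Hence, for open sets `W i`, all suprema over sets of indices of the functions
`f i y = ⨆ z ∈ Φ y, infEDist z (W i)ᶜ` are continuous. Well-order the indices: for `lo < hi`, the
cozero sets of the `y` at which `f i` exceeds `hi` while all earlier `f j` stay uniformly below `lo`
form a discrete family, and letting `hi = 2⁻ⁿ` they refine the sets of the `y` with `Φ y` meeting
`W i`. A countable union of discrete cozero families that covers the space carries a partition of
unity. As in Michael's theorem, these partitions give approximate selections, and successive
approximation gives a selection close to any given continuous approximate one.

In a collectionwise normal space the discrete cozero families of a closed subset `A` extend to the
whole space, hence so do the partitions of unity, and the same successive approximation (with values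
`{g x}` on `A` and `E` off `A`) extends `g` to a continuous `φ : X → E`. The function
`min 1 (infDist (φ x) (Φ x))` is upper semicontinuous and vanishes on `A`, so it lies below a
continuous `η ≥ 0` vanishing on `A`. On `{η ≠ 0}`, where `Φ` is proximal continuous, there is a
selection within `6 η` of `φ` wherever `η ≤ 1 / 2`; glued to `φ` on `{η = 0}`, it stays continuous.
-/

open Filter Function Metric Set
open scoped ENNReal

section DiscreteFamilies

variable {X Y ι : Type*} [TopologicalSpace X] [TopologicalSpace Y] {s t : ι → Set X}

theorem IsDiscreteFamily.locallyFinite (hs : IsDiscreteFamily s) : LocallyFinite s := fun x =>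
  let ⟨N, hN, h⟩ := hs x
  ⟨N, hN, h.finite⟩

theorem IsDiscreteFamily.mono (hs : IsDiscreteFamily s) (hts : ∀ i, t i ⊆ s i) :
    IsDiscreteFamily t := fun x =>
  let ⟨N, hN, h⟩ := hs x
  ⟨N, hN, h.anti fun i hi => hi.mono (inter_subset_inter_left N (hts i))⟩

theorem IsDiscreteFamily.eq_of_mem (hs : IsDiscreteFamily s) {x : X} {i j : ι} (hi : x ∈ s i)
    (hj : x ∈ s j) : i = j :=
  let ⟨_, hN, h⟩ := hs x
  h ⟨x, hi, mem_of_mem_nhds hN⟩ ⟨x, hj, mem_of_mem_nhds hN⟩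

theorem IsDiscreteFamily.closure (hs : IsDiscreteFamily s) :
    IsDiscreteFamily fun i => closure (s i) := fun x =>
  let ⟨N, hN, h⟩ := hs x
  ⟨interior N, interior_mem_nhds.2 hN, h.anti fun _ hi =>
    ((closure_inter_open_nonempty_iff isOpen_interior).1 hi).mono
      (inter_subset_inter_right _ interior_subset)⟩

theorem IsDiscreteFamily.image_of_isClosedEmbedding {s : ι → Set Y} (hs : IsDiscreteFamily s)
    {e : Y → X} (he : IsClosedEmbedding e) : IsDiscreteFamily fun i => e '' s i := by
  intro x
  by_cases hx : x ∈ range e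
  · obtain ⟨y, rfl⟩ := hx
    obtain ⟨N, hN, h⟩ := hs y
    rw [he.isInducing.nhds_eq_comap, mem_comap] at hN
    obtain ⟨M, hM, hMN⟩ := hN
    refine ⟨M, hM, h.anti ?_⟩
    rintro i ⟨_, ⟨z, hz, rfl⟩, hzM⟩
    exact ⟨z, hz, hMN hzM⟩
  · refine ⟨(range e)ᶜ, he.isClosed_range.isOpen_compl.mem_nhds hx, ?_⟩
    rintro i ⟨_, ⟨z, -, rfl⟩, hz⟩
    exact absurd (mem_range_self z) hz

theorem CollectionwiseNormal.exists_expansion (hX : CollectionwiseNormal X)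
    (hs : IsDiscreteFamily s) :
    ∃ U : ι → Set X, (∀ i, IsOpen (U i)) ∧ (∀ i, s i ⊆ U i) ∧ IsDiscreteFamily U := by
  have hrange : IsDiscreteFamily fun D : range s => (D : Set X) := by
    intro x
    obtain ⟨N, hN, h⟩ := hs x
    refine ⟨N, hN, ?_⟩
    rintro ⟨_, i, rfl⟩ hi ⟨_, j, rfl⟩ hj
    exact Subtype.ext (congrArg s (h hi hj))
  obtain ⟨U, hU, hsU, hUd⟩ := hX (range s) hrange
  -- Empty members of `s` may share one expanding set, so they are expanded to `∅`.
  refine ⟨fun i => {x | x ∈ U ⟨s i, i, rfl⟩ ∧ (s i).Nonempty}, fun i => ?_,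
    fun i x hx => ⟨hsU ⟨s i, i, rfl⟩ hx, x, hx⟩, fun x => ?_⟩
  · exact (hU _).and isOpen_const
  · obtain ⟨N, hN, h⟩ := hUd x
    refine ⟨N, hN, ?_⟩
    rintro i ⟨y, ⟨hyi, z, hz⟩, hyN⟩ j ⟨y', ⟨hyj, -⟩, hyN'⟩
    have hij : s i = s j := congrArg Subtype.val (h ⟨y, hyi, hyN⟩ ⟨y', hyj, hyN'⟩)
    exact hs.eq_of_mem hz (hij ▸ hz)

theorem CollectionwiseNormal.normalSpace (hX : CollectionwiseNormal X) : NormalSpace X := by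
  refine ⟨fun s t hs ht hst => ?_⟩
  have hdisc : IsDiscreteFamily fun b : Bool => cond b s t := by
    intro x
    by_cases hx : x ∈ s
    · refine ⟨tᶜ, ht.isOpen_compl.mem_nhds (disjoint_left.1 hst hx), ?_⟩
      rintro (_ | _) ⟨y, hy, hyt⟩ (_ | _) ⟨z, hz, hzt⟩ <;> first | rfl | contradiction
    · refine ⟨sᶜ, hs.isOpen_compl.mem_nhds hx, ?_⟩
      rintro (_ | _) ⟨y, hy, hys⟩ (_ | _) ⟨z, hz, hzs⟩ <;> first | rfl | contradiction
  obtain ⟨U, hU, hsub, hUd⟩ := hX.exists_expansion hdisc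
  refine ⟨U true, U false, hU true, hU false, hsub true, hsub false, ?_⟩
  exact disjoint_left.2 fun x hs ht => Bool.noConfusion (hUd.eq_of_mem hs ht)

end DiscreteFamilies

/-- A discrete family of cozero sets, encoded by continuous functions into `[0, 1]` whose supports
are the members of the family. -/
structure IsDiscreteCozeroFamily {ι Y : Type*} [TopologicalSpace Y] (k : ι → Y → ℝ) : Prop where
  continuous : ∀ i, Continuous (k i)
  mem_Icc : ∀ i y, k i y ∈ Icc (0 : ℝ) 1
  isDiscreteFamily : IsDiscreteFamily fun i => support (k i)

section PartitionsOfUnity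

variable {ι κ Y : Type*} [TopologicalSpace Y]

namespace IsDiscreteCozeroFamily

variable {k : ι → Y → ℝ}

theorem continuous_finsum (hk : IsDiscreteCozeroFamily k) : Continuous fun y => ∑ᶠ i, k i y :=
  _root_.continuous_finsum hk.continuous hk.isDiscreteFamily.locallyFinite

theorem finsum_eq (hk : IsDiscreteCozeroFamily k) {i : ι} {y : Y} (h : k i y ≠ 0) :
    ∑ᶠ j, k j y = k i y :=
  finsum_eq_single _ i fun _ hj => by_contra fun h' => hj (hk.isDiscreteFamily.eq_of_mem h' h)

theorem finsum_mem_Icc (hk : IsDiscreteCozeroFamily k) (y : Y) :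
    ∑ᶠ i, k i y ∈ Icc (0 : ℝ) 1 := by
  by_cases h : ∃ i, k i y ≠ 0
  · obtain ⟨i, hi⟩ := h
    rw [hk.finsum_eq hi]
    exact hk.mem_Icc i y
  · push Not at h
    simp [h]

end IsDiscreteCozeroFamily

theorem exists_locallyFinite_cozero_shrinking {s : ℕ → Y → ℝ} (hs : ∀ n, Continuous (s n))
    (hs01 : ∀ n y, s n y ∈ Icc (0 : ℝ) 1) (hcov : ∀ y, ∃ n, s n y ≠ 0) :
    ∃ t : ℕ → Y → ℝ, (∀ n, Continuous (t n)) ∧ (∀ n y, 0 ≤ t n y) ∧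
      (LocallyFinite fun n => support (t n)) ∧ (∀ n, support (t n) ⊆ support (s n)) ∧
      ∀ y, ∃ n, t n y ≠ 0 := by
  have hs_pos : ∀ {n y}, s n y ≠ 0 → 0 < s n y := fun h => (hs01 _ _).1.lt_of_ne' h
  let t (n : ℕ) (y : Y) : ℝ := max 0 (s n y - n * ∑ m ∈ Finset.range n, s m y)
  have ht : ∀ {n y}, t n y ≠ 0 ↔ n * ∑ m ∈ Finset.range n, s m y < s n y := by
    simp only [t, Ne, max_eq_left_iff, sub_nonpos, not_le, implies_true]
  refine ⟨t, fun n => by fun_prop, fun n y => le_max_left _ _, fun y => ?_, fun n y hy => ?_,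
    fun y => ?_⟩
  · obtain ⟨m, hm⟩ := hcov y
    -- Near `y`, the term subtracted in `t n` is at least `1 ≥ s n` as soon as `n > m` and `n ≥ M`.
    obtain ⟨M, hM⟩ := exists_nat_gt (s m y / 2)⁻¹
    have hnhds : {x | s m y / 2 < s m x} ∈ 𝓝 y :=
      (isOpen_lt continuous_const (hs m)).mem_nhds (half_lt_self (hs_pos hm))
    refine ⟨_, hnhds, (finite_lt_nat (max M (m + 1))).subset ?_⟩
    rintro n ⟨x, hx, hmx⟩
    rw [mem_ofPred_eq]
    by_contra! hn
    have hsum : s m y / 2 ≤ ∑ l ∈ Finset.range n, s l x :=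
      (le_of_lt hmx).trans <| Finset.single_le_sum (f := fun l => s l x)
        (fun l _ => (hs01 l x).1) (Finset.mem_range.2 ((le_max_right _ _).trans hn))
    have hone : 1 ≤ n * (s m y / 2) := by
      rw [← inv_le_iff_one_le_mul₀ (half_pos (hs_pos hm))]
      exact hM.le.trans (by exact_mod_cast (le_max_left _ _).trans hn)
    have hle : n * (s m y / 2) ≤ n * ∑ l ∈ Finset.range n, s l x := by gcongr
    exact (ht.1 hx).not_ge ((hs01 n x).2.trans (hone.trans hle))
  · have hsum : 0 ≤ ∑ m ∈ Finset.range n, s m y := Finset.sum_nonneg fun m _ => (hs01 m y).1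
    exact ((mul_nonneg n.cast_nonneg hsum).trans_lt (ht.1 hy)).ne'
  · classical
    refine ⟨Nat.find (hcov y), ht.2 ?_⟩
    have hfirst : ∑ m ∈ Finset.range (Nat.find (hcov y)), s m y = 0 :=
      Finset.sum_eq_zero fun m hm => not_not.1 (Nat.find_min (hcov y) (Finset.mem_range.1 hm))
    rw [hfirst, mul_zero]
    exact hs_pos (Nat.find_spec (hcov y))

theorem locallyFinite_inter_prod {S : κ → Set Y} {T : κ → ι → Set Y} (hS : LocallyFinite S)
    (hT : ∀ n, LocallyFinite (T n)) : LocallyFinite fun i : κ × ι => S i.1 ∩ T i.1 i.2 := by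
  intro y
  obtain ⟨N, hN, hfin⟩ := hS y
  choose M hM hMfin using fun n => hT n y
  refine ⟨N ∩ ⋂ n ∈ {n | (S n ∩ N).Nonempty}, M n,
    inter_mem hN ((biInter_mem hfin).2 fun n _ => hM n), ?_⟩
  refine (hfin.biUnion fun n _ => (hMfin n).image (Prod.mk n)).subset ?_
  rintro ⟨n, i⟩ ⟨x, ⟨hxS, hxT⟩, hxN, hxM⟩
  have hn : (S n ∩ N).Nonempty := ⟨x, hxS, hxN⟩
  exact mem_biUnion hn ⟨i, ⟨x, hxT, mem_iInter₂.1 hxM n hn⟩, rfl⟩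

theorem exists_partitionOfUnity_support_eq {q : ι → Y → ℝ} (hq : ∀ i, Continuous (q i))
    (hq0 : ∀ i y, 0 ≤ q i y) (hfin : LocallyFinite fun i => support (q i))
    (hcov : ∀ y, ∃ i, q i y ≠ 0) :
    ∃ p : PartitionOfUnity ι Y, ∀ i, support (p i) = support (q i) := by
  have hpos : ∀ y, 0 < ∑ᶠ i, q i y := fun y =>
    finsum_pos (fun i => hq0 i y) ((hcov y).imp fun i hi => (hq0 i y).lt_of_ne' hi)
      (hfin.point_finite y)
  let p (i : ι) : C(Y, ℝ) := ⟨fun y => q i y * (∑ᶠ j, q j y)⁻¹,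
    (hq i).mul ((continuous_finsum hq hfin).inv₀ fun y => (hpos y).ne')⟩
  have hsupp : ∀ i, support (p i) = support (q i) := fun i => by
    ext y
    exact mul_ne_zero_iff.trans (and_iff_left (inv_ne_zero (hpos y).ne'))
  have hsum : ∀ y, ∑ᶠ i, p i y = 1 := fun y => by
    rw [← mul_inv_cancel₀ (hpos y).ne', finsum_mul]
    rfl
  exact ⟨⟨p, by simpa only [hsupp] using hfin,
    fun i y => mul_nonneg (hq0 i y) (inv_nonneg.2 (hpos y).le), fun y _ => hsum y,
    fun y => (hsum y).le⟩, hsupp⟩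

theorem exists_partitionOfUnity_of_isDiscreteCozeroFamily {k : ℕ → ι → Y → ℝ}
    (hk : ∀ n, IsDiscreteCozeroFamily (k n)) (hcov : ∀ y, ∃ n i, k n i y ≠ 0) :
    ∃ p : PartitionOfUnity (ℕ × ι) Y, ∀ i, support (p i) ⊆ support (k i.1 i.2) := by
  obtain ⟨t, ht, ht0, htfin, hts, htcov⟩ := exists_locallyFinite_cozero_shrinking
    (fun n => (hk n).continuous_finsum) (fun n => (hk n).finsum_mem_Icc)
    fun y => (hcov y).imp fun n ⟨i, hi⟩ => by rwa [(hk n).finsum_eq hi]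
  obtain ⟨p, hp⟩ := exists_partitionOfUnity_support_eq
    (q := fun (i : ℕ × ι) y => t i.1 y * k i.1 i.2 y)
    (fun i => (ht i.1).mul ((hk i.1).continuous i.2))
    (fun i y => mul_nonneg (ht0 _ _) ((hk i.1).mem_Icc _ _).1)
    (by
      simp only [support_mul]
      exact locallyFinite_inter_prod htfin fun n => (hk n).isDiscreteFamily.locallyFinite)
    (fun y => by
      obtain ⟨n, hn⟩ := htcov y
      obtain ⟨i, hi⟩ : ∃ i, k n i y ≠ 0 := by
        by_contra! h
        exact hts n hn (by simp only [h, finsum_zero])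
      exact ⟨(n, i), mul_ne_zero hn hi⟩)
  exact ⟨p, fun i => (hp i).trans_subset (support_mul_subset_right _ _)⟩

end PartitionsOfUnity

section ContinuousSuprema

variable {ι Y : Type*} [TopologicalSpace Y] {f : ι → Y → ℝ≥0∞}

theorem continuous_of_continuous_biSup
    (hf : ∀ J : Set ι, Continuous fun y => ⨆ i ∈ J, f i y) (i : ι) : Continuous (f i) := by
  simpa only [mem_singleton_iff, iSup_iSup_eq_left] using hf {i}

theorem isDiscreteFamily_of_continuous_biSup [LinearOrder ι] [WellFoundedLT ι]
    (hf : ∀ J : Set ι, Continuous fun y => ⨆ i ∈ J, f i y) {lo hi : ℝ≥0∞} (hlo : lo < hi) :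
    IsDiscreteFamily fun i => {y | hi < f i y ∧ ⨆ j ∈ Iio i, f j y < lo} := by
  intro y
  obtain ⟨mid, hlo_mid, hmid_hi⟩ := exists_between hlo
  by_cases hy : ∃ i, mid < f i y
  · obtain ⟨i₀, hi₀, hmin⟩ := exists_minimal_of_wellFoundedLT (fun i => mid < f i y) hy
    have hbelow : ⨆ j ∈ Iio i₀, f j y < hi :=
      (iSup₂_le fun j hj => not_lt.1 fun h => (hmin h (le_of_lt hj)).not_gt hj).trans_lt hmid_hi
    have hfi₀ : Continuous (f i₀) := continuous_of_continuous_biSup hf i₀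
    refine ⟨{x | lo < f i₀ x} ∩ {x | ⨆ j ∈ Iio i₀, f j x < hi}, inter_mem
      ((isOpen_lt continuous_const hfi₀).mem_nhds (hlo_mid.trans hi₀))
      ((isOpen_lt (hf _) continuous_const).mem_nhds hbelow), ?_⟩
    have heq : ∀ i ∈ {i | ({y | hi < f i y ∧ ⨆ j ∈ Iio i, f j y < lo} ∩
        ({x | lo < f i₀ x} ∩ {x | ⨆ j ∈ Iio i₀, f j x < hi})).Nonempty}, i = i₀ := by
      rintro i ⟨x, ⟨hi_lt, hlt_lo⟩, hlo_lt, hlt_hi⟩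
      rcases lt_trichotomy i i₀ with h | h | h
      · exact absurd (hi_lt.trans_le (le_iSup₂_of_le i h le_rfl)) hlt_hi.not_gt
      · exact h
      · exact absurd (hlo_lt.trans_le (le_iSup₂_of_le i₀ h le_rfl)) hlt_lo.not_gt
    exact fun i hi j hj => (heq i hi).trans (heq j hj).symm
  · push Not at hy
    refine ⟨{x | ⨆ i ∈ univ, f i x < hi}, (isOpen_lt (hf _) continuous_const).mem_nhds
      ((iSup₂_le fun i _ => hy i).trans_lt hmid_hi), ?_⟩
    rintro i ⟨x, ⟨hi_lt, -⟩, hlt_hi⟩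
    exact absurd (hi_lt.trans_le (le_iSup₂_of_le i trivial le_rfl)) hlt_hi.not_gt

theorem exists_isDiscreteCozeroFamily_support_eq [LinearOrder ι] [WellFoundedLT ι]
    (hf : ∀ J : Set ι, Continuous fun y => ⨆ i ∈ J, f i y) {lo hi : ℝ≥0∞} (hlo : lo < hi)
    (hlo1 : lo ≤ 1) :
    ∃ k : ι → Y → ℝ, IsDiscreteCozeroFamily k ∧
      ∀ i, support (k i) = {y | hi < f i y ∧ ⨆ j ∈ Iio i, f j y < lo} := by
  let m (i : ι) (y : Y) : ℝ≥0∞ := min (f i y - hi) (lo - ⨆ j ∈ Iio i, f j y)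
  have hm1 : ∀ i y, m i y ≤ 1 := fun i y => (min_le_right _ _).trans (tsub_le_self.trans hlo1)
  have hm_top : ∀ i y, m i y ≠ ⊤ := fun i y => ne_top_of_le_ne_top ENNReal.one_ne_top (hm1 i y)
  have hsupp : ∀ i, support (fun y => (m i y).toReal) =
      {y | hi < f i y ∧ ⨆ j ∈ Iio i, f j y < lo} := fun i => by
    ext y
    rw [mem_support, ENNReal.toReal_ne_zero, and_iff_left (hm_top i y), ← pos_iff_ne_zero,
      lt_min_iff, tsub_pos_iff_lt, tsub_pos_iff_lt, mem_ofPred_eq]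
  refine ⟨fun i y => (m i y).toReal, ⟨fun i => ?_, fun i y => ⟨ENNReal.toReal_nonneg, ?_⟩, ?_⟩,
    hsupp⟩
  · have hm : Continuous (m i) := ((ENNReal.continuous_sub_right hi).comp
        (continuous_of_continuous_biSup hf i)).min
      ((ENNReal.continuous_sub_left (ne_top_of_le_ne_top ENNReal.one_ne_top hlo1)).comp (hf _))
    exact ENNReal.continuousOn_toReal.comp_continuous hm fun y => hm_top i y
  · exact ENNReal.toReal_mono ENNReal.one_ne_top (hm1 i y)
  · simpa only [hsupp] using isDiscreteFamily_of_continuous_biSup hf hlo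

theorem exists_isDiscreteCozeroFamily_of_continuous_biSup
    (hf : ∀ J : Set ι, Continuous fun y => ⨆ i ∈ J, f i y) (hcov : ∀ y, ∃ i, f i y ≠ 0) :
    ∃ k : ℕ → ι → Y → ℝ, (∀ n, IsDiscreteCozeroFamily (k n)) ∧
      (∀ n i y, k n i y ≠ 0 → f i y ≠ 0) ∧ ∀ y, ∃ n i, k n i y ≠ 0 := by
  obtain ⟨_, _⟩ := exists_wellFoundedLT ι
  let c (n : ℕ) : ℝ≥0∞ := 2⁻¹ ^ n
  have hc0 : ∀ n, c n ≠ 0 := fun n => pow_ne_zero n (by simp)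
  have hc1 : ∀ n, c n ≤ 1 := fun n => pow_le_one' (by simp) n
  choose k hk hsupp using fun n => exists_isDiscreteCozeroFamily_support_eq hf
    (ENNReal.half_lt_self (hc0 n) (ne_top_of_le_ne_top ENNReal.one_ne_top (hc1 n)))
    (ENNReal.half_le_self.trans (hc1 n))
  have hmem : ∀ {n i y}, k n i y ≠ 0 ↔ c n < f i y ∧ ⨆ j ∈ Iio i, f j y < c n / 2 :=
    fun {n i y} => Set.ext_iff.1 (hsupp n i) y
  refine ⟨k, hk, fun n i y h => (hmem.1 h).1.ne_bot, fun y => ?_⟩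
  obtain ⟨i₀, hi₀, hmin⟩ := exists_minimal_of_wellFoundedLT (fun i => f i y ≠ 0) (hcov y)
  obtain ⟨n, hn⟩ := ENNReal.exists_inv_two_pow_lt hi₀
  have hbelow : ⨆ j ∈ Iio i₀, f j y = 0 :=
    ENNReal.iSup_eq_zero.2 fun j => ENNReal.iSup_eq_zero.2 fun hj =>
      not_not.1 fun h => (hmin h (le_of_lt hj)).not_gt hj
  exact ⟨n, i₀, hmem.2 ⟨hn, hbelow ▸ ENNReal.half_pos (hc0 n)⟩⟩

end ContinuousSuprema

section ProximalContinuity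

theorem lowerSemicontinuous_biSup_of_lowerHemicontinuous {Y Z : Type*} [TopologicalSpace Y]
    [TopologicalSpace Z] {Φ : Y → Set Z} (hΦ : LowerHemicontinuous Φ) {v : Z → ℝ≥0∞}
    (hv : LowerSemicontinuous v) : LowerSemicontinuous fun y => ⨆ z ∈ Φ y, v z := by
  intro y r hr
  obtain ⟨z, hz, hrz⟩ := lt_biSup_iff.1 hr
  filter_upwards [hΦ y {z | r < v z} ⟨hv.isOpen_preimage r, z, hz, hrz⟩] with x hx
  obtain ⟨-, z', hz', hrz'⟩ := hx
  exact lt_biSup_iff.2 ⟨z', hz', hrz'⟩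

theorem lowerHemicontinuous_prod {Y Z Z' : Type*} [TopologicalSpace Y] [TopologicalSpace Z]
    [TopologicalSpace Z'] {Φ : Y → Set Z} {Ψ : Y → Set Z'} (hΦ : LowerHemicontinuous Φ)
    (hΨ : LowerHemicontinuous Ψ) : LowerHemicontinuous fun y => Φ y ×ˢ Ψ y := by
  rintro y u ⟨hu, ⟨z, z'⟩, ⟨hz, hz'⟩, hzu⟩
  obtain ⟨U, V, hU, hV, hzU, hzV, hUV⟩ := isOpen_prod_iff.1 hu z z' hzu
  filter_upwards [hΦ y U ⟨hU, z, hz, hzU⟩, hΨ y V ⟨hV, z', hz', hzV⟩]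
  rintro x ⟨-, w, hw, hwU⟩ ⟨-, w', hw', hwV⟩
  exact ⟨hu, (w, w'), ⟨hw, hw'⟩, hUV ⟨hwU, hwV⟩⟩

namespace SetValuedMetricUSC

variable {Y Z Z' : Type*} [TopologicalSpace Y] [MetricSpace Z] [MetricSpace Z']
  {Φ : Y → Set Z} {Ψ : Y → Set Z'}

theorem upperSemicontinuous_biSup (hΦ : SetValuedMetricUSC Φ) {v : Z → ℝ≥0∞}
    (hv : ∀ z z', v z ≤ v z' + edist z z') : UpperSemicontinuous fun y => ⨆ z ∈ Φ y, v z := by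
  intro y r hr
  obtain ⟨ε, hε, hεr⟩ := ENNReal.lt_iff_exists_add_pos_lt.1 hr
  obtain ⟨V, hV, hVΦ⟩ := hΦ ε hε y
  filter_upwards [hV] with x hx
  refine (iSup₂_le fun z hz => ?_).trans_lt hεr
  obtain ⟨z', hz', hzz'⟩ := mem_thickening_iff.1 (hVΦ x hx hz)
  calc v z ≤ v z' + edist z z' := hv z z'
    _ ≤ (⨆ z ∈ Φ y, v z) + ε := by
      gcongr
      · exact le_iSup₂ (f := fun z _ => v z) z' hz'
      · rw [edist_dist]
        exact ENNReal.ofReal_le_of_le_toReal hzz'.le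

theorem continuous_biSup (hΦ : SetValuedMetricUSC Φ) (hlsc : LowerHemicontinuous Φ)
    {v : Z → ℝ≥0∞} (hv : ∀ z z', v z ≤ v z' + edist z z') :
    Continuous fun y => ⨆ z ∈ Φ y, v z := by
  have hv_cont : Continuous v :=
    continuous_of_le_add_edist 1 ENNReal.one_ne_top (by simpa only [one_mul] using hv)
  exact continuous_iff_lower_upperSemicontinuous.2
    ⟨lowerSemicontinuous_biSup_of_lowerHemicontinuous hlsc hv_cont.lowerSemicontinuous,
      hΦ.upperSemicontinuous_biSup hv⟩

theorem comp {X : Type*} [TopologicalSpace X] (hΦ : SetValuedMetricUSC Φ) {e : X → Y}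
    (he : Continuous e) : SetValuedMetricUSC (Φ ∘ e) := by
  intro ε hε x
  obtain ⟨V, hV, h⟩ := hΦ ε hε (e x)
  exact ⟨e ⁻¹' V, he.continuousAt hV, fun x' hx' => h (e x') hx'⟩

theorem prod (hΦ : SetValuedMetricUSC Φ) (hΨ : SetValuedMetricUSC Ψ) :
    SetValuedMetricUSC fun y => Φ y ×ˢ Ψ y := by
  intro ε hε y
  obtain ⟨V, hV, hVΦ⟩ := hΦ ε hε y
  obtain ⟨W, hW, hWΨ⟩ := hΨ ε hε y
  refine ⟨V ∩ W, inter_mem hV hW, ?_⟩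
  rintro x ⟨hxV, hxW⟩ ⟨z, z'⟩ ⟨hz, hz'⟩
  obtain ⟨w, hw, hzw⟩ := mem_thickening_iff.1 (hVΦ x hxV hz)
  obtain ⟨w', hw', hzw'⟩ := mem_thickening_iff.1 (hWΨ x hxW hz')
  exact mem_thickening_iff.2 ⟨(w, w'), ⟨hw, hw'⟩, max_lt hzw hzw'⟩

end SetValuedMetricUSC

theorem setValuedMetricUSC_singleton {Y Z : Type*} [TopologicalSpace Y] [MetricSpace Z]
    {c : Y → Z} (hc : Continuous c) : SetValuedMetricUSC fun y => {c y} := by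
  intro ε hε y
  refine ⟨c ⁻¹' ball (c y) ε, hc.continuousAt (ball_mem_nhds _ hε), fun x hx => ?_⟩
  rw [thickening_singleton, singleton_subset_iff]
  exact hx

theorem proximalContinuous_singleton {Y Z : Type*} [TopologicalSpace Y] [MetricSpace Z]
    {c : Y → Z} (hc : Continuous c) : ProximalContinuous fun y => {c y} :=
  ⟨lowerHemicontinuous_singleton_iff.2 hc, _, rfl, setValuedMetricUSC_singleton hc⟩

namespace ProximalContinuous

variable {ι Y Z Z' : Type*} [TopologicalSpace Y] [TopologicalSpace Z] [TopologicalSpace Z']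
  {Φ : Y → Set Z} {Ψ : Y → Set Z'}

theorem comp {X : Type*} [TopologicalSpace X] (hΦ : ProximalContinuous Φ) {e : X → Y}
    (he : Continuous e) : ProximalContinuous (Φ ∘ e) := by
  obtain ⟨hlsc, d, rfl, husc⟩ := hΦ
  exact ⟨Semicontinuous.comp hlsc he, d, rfl, husc.comp he⟩

theorem prod (hΦ : ProximalContinuous Φ) (hΨ : ProximalContinuous Ψ) :
    ProximalContinuous fun y => Φ y ×ˢ Ψ y := by
  refine ⟨lowerHemicontinuous_prod hΦ.1 hΨ.1, ?_⟩
  obtain ⟨-, d, rfl, hΦ⟩ := hΦ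
  obtain ⟨-, d', rfl, hΨ⟩ := hΨ
  exact ⟨inferInstance, rfl, hΦ.prod hΨ⟩

theorem exists_isDiscreteCozeroFamily (hΦ : ProximalContinuous Φ) {W : ι → Set Z}
    (hW : ∀ i, IsOpen (W i)) (hcov : ∀ y, ∃ i, (Φ y ∩ W i).Nonempty) :
    ∃ k : ℕ → ι → Y → ℝ, (∀ n, IsDiscreteCozeroFamily (k n)) ∧
      (∀ n i y, k n i y ≠ 0 → (Φ y ∩ W i).Nonempty) ∧ ∀ y, ∃ n i, k n i y ≠ 0 := by
  obtain ⟨hlsc, d, rfl, husc⟩ := hΦ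
  have hmeets : ∀ i y, ⨆ z ∈ Φ y, infEDist z (W i)ᶜ ≠ 0 ↔ (Φ y ∩ W i).Nonempty := by
    intro i y
    simp only [← pos_iff_ne_zero, lt_biSup_iff, infEDist_pos_iff_notMem_closure,
      (hW i).isClosed_compl.closure_eq, notMem_compl_iff]
    rfl
  have hcont : ∀ J : Set ι, Continuous fun y => ⨆ i ∈ J, ⨆ z ∈ Φ y, infEDist z (W i)ᶜ := by
    intro J
    have hlip : ∀ z z', ⨆ i ∈ J, infEDist z (W i)ᶜ ≤ (⨆ i ∈ J, infEDist z' (W i)ᶜ) + edist z z' :=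
      fun z z' => iSup₂_le fun i hi => infEDist_le_infEDist_add_edist.trans <| by
        gcongr
        exact le_iSup₂ (f := fun i _ => infEDist z' (W i)ᶜ) i hi
    have hswap : ∀ y, ⨆ i ∈ J, ⨆ z ∈ Φ y, infEDist z (W i)ᶜ =
        ⨆ z ∈ Φ y, ⨆ i ∈ J, infEDist z (W i)ᶜ := fun y => iSup₂_comm _
    simpa only [hswap] using husc.continuous_biSup hlsc hlip
  obtain ⟨k, hk, hk_ne, hk_cov⟩ := exists_isDiscreteCozeroFamily_of_continuous_biSup hcont
    fun y => (hcov y).imp fun i => (hmeets i y).2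
  exact ⟨k, hk, fun n i y h => (hmeets i y).1 (hk_ne n i y h), hk_cov⟩

theorem exists_continuous_mem_of_cover {E : Type*} [AddCommGroup E] [Module ℝ E]
    [TopologicalSpace E] [ContinuousAdd E] [ContinuousSMul ℝ E] (hΦ : ProximalContinuous Φ)
    {W : ι → Set Z} (hW : ∀ i, IsOpen (W i)) (hcov : ∀ y, ∃ i, (Φ y ∩ W i).Nonempty) (v : ι → E)
    {T : Y → Set E} (hT : ∀ y, Convex ℝ (T y)) (hvT : ∀ y i, (Φ y ∩ W i).Nonempty → v i ∈ T y) :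
    ∃ f : Y → E, Continuous f ∧ ∀ y, f y ∈ T y := by
  obtain ⟨k, hk, hkW, hk_cov⟩ := hΦ.exists_isDiscreteCozeroFamily hW hcov
  obtain ⟨p, hp⟩ := exists_partitionOfUnity_of_isDiscreteCozeroFamily hk hk_cov
  exact ⟨fun y => ∑ᶠ i, p i y • v i.2,
    p.continuous_finsum_smul fun _ _ _ => continuousAt_const,
    fun y => p.finsum_smul_mem_convex (g := fun i _ => v i.2) (mem_univ y)
      (fun i hi => hvT y i.2 (hkW i.1 i.2 y (hp i hi))) (hT y)⟩

end ProximalContinuous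

end ProximalContinuity

section ApproximateSelections

/-- A continuous map whose value at each `y` is at distance less than `η y` from `Φ y`: the objects
that the successive approximations producing a selection of `Φ` run through. -/
def IsApproxSelection {Y E : Type*} [TopologicalSpace Y] [PseudoMetricSpace E] (Φ : Y → Set E)
    (η : Y → ℝ) (φ : Y → E) : Prop :=
  Continuous φ ∧ ∀ y, φ y ∈ thickening (η y) (Φ y)

variable {Y E : Type*} [TopologicalSpace Y]

theorem exists_continuous_dist_le_of_le_geometric_two [PseudoMetricSpace E] [CompleteSpace E]
    {φ : ℕ → Y → E} (hφ : ∀ n, Continuous (φ n)) {η : Y → ℝ} (hη : Continuous η)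
    (h : ∀ y n, dist (φ n y) (φ (n + 1) y) ≤ η y / 2 / 2 ^ n) :
    ∃ f : Y → E, Continuous f ∧ ∀ y n, dist (φ n y) (f y) ≤ η y / 2 ^ n := by
  choose f hf using fun y => cauchySeq_tendsto_of_complete (cauchySeq_of_le_geometric_two (h y))
  have hdist : ∀ y n, dist (φ n y) (f y) ≤ η y / 2 ^ n := fun y n =>
    dist_le_of_le_geometric_two_of_tendsto (h y) (hf y) n
  have hunif : TendstoLocallyUniformly φ f atTop := by
    rw [Metric.tendstoLocallyUniformly_iff]
    intro ε hε y
    have hpow : Tendsto (fun n : ℕ => (η y + 1) / 2 ^ n) atTop (𝓝 0) :=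
      tendsto_const_nhds.div_atTop (tendsto_pow_atTop_atTop_of_one_lt one_lt_two)
    refine ⟨{x | η x < η y + 1}, (isOpen_lt hη continuous_const).mem_nhds (lt_add_one (η y)), ?_⟩
    filter_upwards [hpow.eventually_lt_const hε] with n hn x hx
    rw [dist_comm]
    refine ((hdist x n).trans ?_).trans_lt hn
    gcongr
  exact ⟨f, hunif.continuous (Frequently.of_forall hφ), hdist⟩

theorem IsApproxSelection.exists_selection [PseudoMetricSpace E] [CompleteSpace E] {Φ : Y → Set E}
    (hclosed : ∀ y, IsClosed (Φ y)) {η : Y → ℝ} (hη : Continuous η) {C : ℝ}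
    (himprove : ∀ (n : ℕ) (φ : Y → E), IsApproxSelection Φ (fun y => η y / 2 ^ n) φ →
      ∃ f, IsApproxSelection Φ (fun y => η y / 2 ^ (n + 1)) f ∧
        ∀ y, dist (φ y) (f y) ≤ C * (η y / 2 ^ n))
    {φ : Y → E} (hφ : IsApproxSelection Φ η φ) :
    ∃ f : Y → E, Continuous f ∧ (∀ y, f y ∈ Φ y) ∧ ∀ y, dist (φ y) (f y) ≤ 2 * C * η y := by
  choose! next hnext hdist using himprove
  let seq (n : ℕ) : Y → E := Nat.rec φ next n
  have hφ0 : IsApproxSelection Φ (fun y => η y / 2 ^ 0) φ := by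
    simpa only [pow_zero, div_one] using hφ
  have hseq : ∀ n, IsApproxSelection Φ (fun y => η y / 2 ^ n) (seq n) := by
    intro n
    induction n with
    | zero => exact hφ0
    | succ n ih => exact hnext n _ ih
  obtain ⟨f, hf, hfseq⟩ := exists_continuous_dist_le_of_le_geometric_two (fun n => (hseq n).1)
    (η := fun y => 2 * C * η y) (by fun_prop) fun y n =>
      (hdist n _ (hseq n) y).trans_eq (by ring)
  refine ⟨f, hf, fun y => ?_, fun y => (hfseq y 0).trans_eq (by rw [pow_zero, div_one])⟩
  have hlim : ∀ a : ℝ, Tendsto (fun n : ℕ => a / 2 ^ n) atTop (𝓝 0) := fun a =>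
    tendsto_const_nhds.div_atTop (tendsto_pow_atTop_atTop_of_one_lt one_lt_two)
  rw [← (hclosed y).closure_eq, Metric.mem_closure_iff]
  intro ε hε
  obtain ⟨n, hn⟩ := ((hlim (2 * C * η y + η y)).eventually_lt_const hε).exists
  obtain ⟨z, hz, hzseq⟩ := mem_thickening_iff.1 ((hseq n).2 y)
  refine ⟨z, hz, (dist_triangle_left _ _ (seq n y)).trans_lt ?_⟩
  rw [add_div] at hn
  linarith [hfseq y n]

namespace ProximalContinuous

variable [NormedAddCommGroup E] [NormedSpace ℝ E] {Φ : Y → Set E}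

theorem exists_isApproxSelection_half (hΦ : ProximalContinuous Φ) (hconvex : ∀ y, Convex ℝ (Φ y))
    {η : Y → ℝ} (hη : Continuous η) {φ : Y → E} (hφ : IsApproxSelection Φ η φ) :
    ∃ f, IsApproxSelection Φ (fun y => η y / 2) f ∧ ∀ y, dist (φ y) (f y) ≤ 3 / 2 * η y := by
  have hprod : ProximalContinuous fun y => {(φ y, η y)} ×ˢ Φ y :=
    (proximalContinuous_singleton (hφ.1.prodMk hη)).prod hΦ
  let W (v : E) : Set ((E × ℝ) × E) := {q | dist q.1.1 q.2 < q.1.2 ∧ dist v q.2 < q.1.2 / 2}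
  have hW : ∀ v, IsOpen (W v) := fun v =>
    (isOpen_lt (by fun_prop) (by fun_prop)).and (isOpen_lt (by fun_prop) (by fun_prop))
  have hmeets : ∀ y v, (({(φ y, η y)} ×ˢ Φ y) ∩ W v).Nonempty ↔
      ∃ z ∈ Φ y, dist (φ y) z < η y ∧ dist v z < η y / 2 := by
    refine fun y v => ⟨?_, fun ⟨z, hz, h⟩ => ⟨((φ y, η y), z), ⟨rfl, hz⟩, h⟩⟩
    rintro ⟨⟨_, z⟩, ⟨rfl, hz⟩, h⟩
    exact ⟨z, hz, h⟩
  obtain ⟨f, hf, hfT⟩ := hprod.exists_continuous_mem_of_cover hW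
    (fun y => by
      obtain ⟨z, hz, hφz⟩ := mem_thickening_iff.1 (hφ.2 y)
      refine ⟨z, (hmeets y z).2 ⟨z, hz, hφz, ?_⟩⟩
      rw [dist_self]
      exact half_pos (dist_nonneg.trans_lt hφz))
    id (T := fun y => thickening (η y / 2) (Φ y) ∩ closedBall (φ y) (3 / 2 * η y))
    (fun y => ((hconvex y).thickening _).inter (convex_closedBall _ _))
    (fun y v hv => by
      obtain ⟨z, hz, hφz, hvz⟩ := (hmeets y v).1 hv
      have hvφ : dist v (φ y) ≤ 3 / 2 * η y := by linarith [dist_triangle_right v (φ y) z]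
      exact ⟨mem_thickening_iff.2 ⟨z, hz, hvz⟩, hvφ⟩)
  exact ⟨f, ⟨hf, fun y => (hfT y).1⟩, fun y => mem_closedBall'.1 (hfT y).2⟩

variable [CompleteSpace E]

theorem exists_selection_of_isApproxSelection (hΦ : ProximalContinuous Φ)
    (hclosed : ∀ y, IsClosed (Φ y)) (hconvex : ∀ y, Convex ℝ (Φ y)) {η : Y → ℝ}
    (hη : Continuous η) {φ : Y → E} (hφ : IsApproxSelection Φ η φ) :
    ∃ f : Y → E, Continuous f ∧ (∀ y, f y ∈ Φ y) ∧ ∀ y, dist (φ y) (f y) ≤ 3 * η y := by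
  obtain ⟨f, hf, hfΦ, hφf⟩ := hφ.exists_selection hclosed hη (C := 3 / 2) fun n φ hφ => by
    simpa only [div_div, pow_succ] using
      hΦ.exists_isApproxSelection_half hconvex (hη.div_const (2 ^ n)) hφ
  exact ⟨f, hf, hfΦ, fun y => (hφf y).trans_eq (by ring)⟩

theorem exists_selection (hΦ : ProximalContinuous Φ) (hne : ∀ y, (Φ y).Nonempty)
    (hclosed : ∀ y, IsClosed (Φ y)) (hconvex : ∀ y, Convex ℝ (Φ y)) :
    ∃ f : Y → E, Continuous f ∧ ∀ y, f y ∈ Φ y := by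
  obtain ⟨φ, hφ⟩ := hΦ.exists_continuous_mem_of_cover (fun v : E => isOpen_ball (x := v) (ε := 1))
    (fun y => (hne y).imp fun z hz => ⟨z, hz, mem_ball_self one_pos⟩) id
    (fun y => (hconvex y).thickening 1)
    fun y v ⟨z, hz, hzv⟩ => mem_thickening_iff.2 ⟨z, hz, mem_ball'.1 hzv⟩
  obtain ⟨f, hf, hfΦ, -⟩ :=
    hΦ.exists_selection_of_isApproxSelection hclosed hconvex continuous_const hφ
  exact ⟨f, hf, hfΦ⟩

end ProximalContinuous

end ApproximateSelections

section ExtensionTheorem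

theorem isDiscreteCozeroFamily_piSingle {ι Y : Type*} [TopologicalSpace Y] [DecidableEq ι] (i : ι)
    {φ : Y → ℝ} (hφ : Continuous φ) (hφ01 : ∀ y, φ y ∈ Icc (0 : ℝ) 1) :
    IsDiscreteCozeroFamily (Pi.single i φ : ι → Y → ℝ) := by
  refine ⟨fun j => ?_, fun j y => ?_, fun y => ⟨univ, univ_mem, ?_⟩⟩
  · rcases eq_or_ne j i with rfl | hj
    · rwa [Pi.single_eq_same]
    · rw [Pi.single_eq_of_ne hj]
      exact continuous_zero
  · rcases eq_or_ne j i with rfl | hj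
    · simpa only [Pi.single_eq_same] using hφ01 y
    · simp [Pi.single_eq_of_ne hj]
  · refine (subsingleton_singleton (a := i)).anti ?_
    rintro j ⟨x, hx, -⟩
    by_contra hj
    exact hx (by rw [Pi.single_eq_of_ne hj, Pi.zero_apply])

theorem exists_continuous_extension_support_subset {X : Type*} [TopologicalSpace X]
    [NormalSpace X] {A U : Set X} (hA : IsClosed A) (hU : IsOpen U) {k : A → ℝ}
    (hk : Continuous k) (hk01 : ∀ a, k a ∈ Icc (0 : ℝ) 1)
    (hkU : closure ((↑) '' support k) ⊆ U) :
    ∃ K : X → ℝ, Continuous K ∧ (∀ x, K x ∈ Icc (0 : ℝ) 1) ∧ support K ⊆ U ∧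
      ∀ a : A, K a = k a := by
  obtain ⟨F, hF01, hFk⟩ := ContinuousMap.exists_restrict_eq_forall_mem_of_closed
    ⟨k, hk⟩ hk01 ⟨0, left_mem_Icc.2 zero_le_one⟩ hA
  obtain ⟨u, hu0, hu1, hu01⟩ := exists_continuous_zero_one_of_isClosed hU.isClosed_compl
    isClosed_closure (disjoint_compl_left_iff_subset.2 hkU)
  refine ⟨fun x => F x * u x, by fun_prop, fun x => ⟨mul_nonneg (hF01 x).1 (hu01 x).1,
    mul_le_one₀ (hF01 x).2 (hu01 x).1 (hu01 x).2⟩, fun x hx => ?_, fun a => ?_⟩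
  · by_contra hxU
    exact right_ne_zero_of_mul hx (hu0 hxU)
  · have hFa : F a = k a := congrArg (fun G : C(A, ℝ) => G a) hFk
    change F a * u a = k a
    by_cases ha : k a = 0
    · rw [hFa, ha, zero_mul]
    · rw [hFa, hu1 (subset_closure ⟨a, ha, rfl⟩), Pi.one_apply, mul_one]

namespace CollectionwiseNormal

variable {X : Type*} [TopologicalSpace X] {A : Set X}

theorem exists_isDiscreteCozeroFamily_extension {ι : Type*} (hX : CollectionwiseNormal X)
    (hA : IsClosed A) {k : ι → A → ℝ} (hk : IsDiscreteCozeroFamily k) :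
    ∃ K : ι → X → ℝ, IsDiscreteCozeroFamily K ∧ ∀ i (a : A), K i a = k i a := by
  have := hX.normalSpace
  obtain ⟨U, hU, hkU, hUdisc⟩ := hX.exists_expansion
    (hk.isDiscreteFamily.image_of_isClosedEmbedding hA.isClosedEmbedding_subtypeVal).closure
  choose K hK hK01 hKU hKk using fun i =>
    exists_continuous_extension_support_subset hA (hU i) (hk.continuous i) (hk.mem_Icc i) (hkU i)
  exact ⟨K, ⟨hK, hK01, hUdisc.mono hKU⟩, hKk⟩

theorem exists_partitionOfUnity {ι : Type*} [Nonempty ι] (hX : CollectionwiseNormal X)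
    (hA : IsClosed A) {k : ℕ → ι → A → ℝ} (hk : ∀ n, IsDiscreteCozeroFamily (k n))
    (hcov : ∀ a, ∃ n i, k n i a ≠ 0) :
    ∃ p : PartitionOfUnity (ℕ × ι) X, ∀ i (a : A), p i a ≠ 0 → ∃ n, k n i.2 a ≠ 0 := by
  classical
  have := hX.normalSpace
  choose K hK hKk using fun n => hX.exists_isDiscreteCozeroFamily_extension hA (hk n)
  let U : Set X := ⋃ n, ⋃ i, support (K n i)
  have hU : IsOpen U := isOpen_iUnion fun n => isOpen_iUnion fun i =>
    ((hK n).continuous i).isOpen_support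
  have hAU : A ⊆ U := fun a ha => by
    obtain ⟨n, i, h⟩ := hcov ⟨a, ha⟩
    exact mem_iUnion₂.2 ⟨n, i, by rwa [mem_support, hKk n i ⟨a, ha⟩]⟩
  obtain ⟨φ, hφ0, hφ1, hφ01⟩ := exists_continuous_zero_one_of_isClosed hA hU.isClosed_compl
    (disjoint_compl_right_iff_subset.2 hAU)
  let K' : ℕ → ι → X → ℝ
    | 0 => Pi.single (Classical.arbitrary ι) φ
    | n + 1 => K n
  have hK' : ∀ n, IsDiscreteCozeroFamily (K' n)
    | 0 => isDiscreteCozeroFamily_piSingle _ φ.continuous hφ01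
    | n + 1 => hK n
  obtain ⟨p, hp⟩ := exists_partitionOfUnity_of_isDiscreteCozeroFamily hK' fun x => by
    by_cases hx : x ∈ U
    · obtain ⟨n, i, h⟩ := mem_iUnion₂.1 hx
      exact ⟨n + 1, i, h⟩
    · refine ⟨0, Classical.arbitrary ι, ?_⟩
      simp [K', hφ1 hx]
  refine ⟨p, fun i a hpa => ?_⟩
  obtain ⟨_ | n, i⟩ := i
  · refine absurd ?_ (hp _ hpa)
    rcases eq_or_ne i (Classical.arbitrary ι) with rfl | hi
    · simp [K', hφ0 a.2]
    · simp [K', Pi.single_eq_of_ne hi]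
  · exact ⟨n, hKk n i a ▸ hp _ hpa⟩

variable {E : Type*} [NormedAddCommGroup E] [NormedSpace ℝ E] {g : A → E}

theorem exists_continuous_mem_dist_lt (hX : CollectionwiseNormal X) (hA : IsClosed A)
    (hg : Continuous g) {C : Set E} (hC : Convex ℝ C) (hC_ne : C.Nonempty) (hgC : ∀ a, g a ∈ C)
    {ε : ℝ} (hε : 0 < ε) :
    ∃ G : X → E, Continuous G ∧ (∀ x, G x ∈ C) ∧ ∀ a : A, dist (G a) (g a) < ε := by
  cases isEmpty_or_nonempty A
  · obtain ⟨c, hc⟩ := hC_ne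
    exact ⟨fun _ => c, continuous_const, fun _ => hc, isEmptyElim⟩
  have hsingle : ProximalContinuous fun a => {g a} := proximalContinuous_singleton hg
  obtain ⟨k, hk, hk_ball, hk_cov⟩ := hsingle.exists_isDiscreteCozeroFamily
    (W := fun b => ball (g b) ε) (fun b => isOpen_ball)
    fun a => ⟨a, g a, rfl, mem_ball_self hε⟩
  have hdist : ∀ {n b a}, k n b a ≠ 0 → dist (g b) (g a) < ε := fun {n b a} h =>
    mem_ball'.1 (singleton_inter_nonempty.1 (hk_ball n b a h))
  obtain ⟨p, hp⟩ := hX.exists_partitionOfUnity hA hk hk_cov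
  refine ⟨fun x => ∑ᶠ i, p i x • g i.2, p.continuous_finsum_smul fun _ _ _ => continuousAt_const,
    fun x => ?_, fun a => ?_⟩
  · exact p.finsum_smul_mem_convex (g := fun i _ => g i.2) (mem_univ x) (fun i _ => hgC i.2) hC
  · refine p.finsum_smul_mem_convex (g := fun i _ => g i.2) (t := ball (g a) ε) (mem_univ _)
      (fun i hi => ?_) (convex_ball _ _)
    obtain ⟨n, hn⟩ := hp i a hi
    exact hdist hn

theorem exists_extension [CompleteSpace E] (hX : CollectionwiseNormal X) (hA : IsClosed A)
    (hg : Continuous g) : ∃ G : X → E, Continuous G ∧ ∀ a : A, G a = g a := by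
  let Φ (x : X) : Set E := {z | ∀ hx : x ∈ A, z = g ⟨x, hx⟩}
  have hclosed : ∀ x, IsClosed (Φ x) := fun x => by
    simp only [Φ, ofPred_forall]
    exact isClosed_iInter fun hx => isClosed_singleton
  have happrox : ∀ {δ : ℝ} {φ : X → E}, 0 < δ →
      (IsApproxSelection Φ (fun _ => δ) φ ↔ Continuous φ ∧ ∀ a : A, dist (φ a) (g a) < δ) := by
    intro δ φ hδ
    refine and_congr_right fun _ => ⟨fun h a => ?_, fun h x => mem_thickening_iff.2 ?_⟩
    · obtain ⟨z, hz, hφz⟩ := mem_thickening_iff.1 (h a)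
      rwa [hz a.2] at hφz
    · by_cases hx : x ∈ A
      · exact ⟨g ⟨x, hx⟩, fun _ => rfl, h ⟨x, hx⟩⟩
      · exact ⟨φ x, fun hxA => absurd hxA hx, by rwa [dist_self]⟩
  obtain ⟨φ, hφ, -, hφg⟩ := hX.exists_continuous_mem_dist_lt hA hg convex_univ univ_nonempty
    (fun _ => mem_univ _) one_pos
  obtain ⟨f, hf, hfΦ, -⟩ := ((happrox one_pos).2 ⟨hφ, hφg⟩).exists_selection hclosed
    continuous_const (C := 1) fun n φ hφ => by
      obtain ⟨hφ, hφg⟩ := (happrox (by positivity)).1 hφ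
      obtain ⟨G, hG, hG_ball, hGg⟩ := hX.exists_continuous_mem_dist_lt hA
        (hg.sub (hφ.comp continuous_subtype_val)) (convex_ball (0 : E) (1 / 2 ^ n))
        (nonempty_ball.2 (by positivity))
        (fun a => by simpa [dist_eq_norm', mem_ball_zero_iff, -mem_ball] using hφg a)
        (ε := 1 / 2 ^ (n + 1)) (by positivity)
      refine ⟨φ + G, (happrox (by positivity)).2 ⟨hφ.add hG, fun a => ?_⟩, fun x => ?_⟩
      · convert hGg a using 1
        simp [dist_eq_norm, sub_sub_eq_add_sub, add_comm]
      · simpa [dist_eq_norm] using (mem_ball_zero_iff.1 (hG_ball x)).le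
  exact ⟨f, hf, fun a => hfΦ a a.2⟩

end CollectionwiseNormal

end ExtensionTheorem

section SelectionsOffAClosedSet

theorem exists_continuous_ge_of_upperSemicontinuous {X : Type*} [TopologicalSpace X]
    [NormalSpace X] {A : Set X} (hA : IsClosed A) {u : X → ℝ} (hu : UpperSemicontinuous u)
    (hu1 : ∀ x, u x ≤ 1) (huA : ∀ x ∈ A, u x ≤ 0) :
    ∃ η : X → ℝ, Continuous η ∧ (∀ x, 0 ≤ η x) ∧ (∀ x ∈ A, η x = 0) ∧ ∀ x, u x ≤ η x := by
  have hopen : ∀ n : ℕ, IsOpen {x | u x < (1 / 2) ^ n} := fun n =>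
    upperSemicontinuous_iff_isOpen_preimage.1 hu _
  choose w hw0 hw1 hw01 using fun n => exists_continuous_zero_one_of_isClosed hA
    (hopen n).isClosed_compl (disjoint_compl_right_iff_subset.2 fun x hx =>
      (huA x hx).trans_lt (by positivity))
  have hnonneg : ∀ x n, 0 ≤ (1 / 2 : ℝ) ^ n * w n x := fun x n =>
    mul_nonneg (by positivity) (hw01 n x).1
  have hle : ∀ x n, (1 / 2 : ℝ) ^ n * w n x ≤ (1 / 2) ^ n := fun x n =>
    mul_le_of_le_one_right (by positivity) (hw01 n x).2
  have hη_nonneg : ∀ x, 0 ≤ 2 * ∑' n, (1 / 2 : ℝ) ^ n * w n x := fun x =>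
    mul_nonneg zero_le_two (tsum_nonneg (hnonneg x))
  refine ⟨fun x => 2 * ∑' n, (1 / 2 : ℝ) ^ n * w n x, ?_, hη_nonneg, fun x hx => ?_, fun x => ?_⟩
  · exact continuous_const.mul (continuous_tsum (fun n => by fun_prop) summable_geometric_two
      fun n x => (Real.norm_of_nonneg (hnonneg x n)).trans_le (hle x n))
  · have hterm : ∀ n, (1 / 2 : ℝ) ^ n * w n x = 0 := fun n => by
      rw [hw0 n hx, Pi.zero_apply, mul_zero]
    simp only [hterm, tsum_zero, mul_zero]
  · rcases le_or_gt (u x) 0 with hux | hux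
    · exact hux.trans (hη_nonneg x)
    obtain ⟨n, hn, hn'⟩ := exists_nat_pow_near_of_lt_one hux (hu1 x) (one_half_pos (α := ℝ))
      one_half_lt_one
    have hsum : Summable fun n => (1 / 2 : ℝ) ^ n * w n x :=
      summable_geometric_two.of_nonneg_of_le (hnonneg x) (hle x)
    have hterm := hsum.le_tsum (n + 1) fun m _ => hnonneg x m
    rw [hw1 (n + 1) hn.not_gt, Pi.one_apply, mul_one, pow_succ] at hterm
    linarith

theorem upperSemicontinuous_infDist_of_lowerHemicontinuous {X E : Type*} [TopologicalSpace X]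
    [PseudoMetricSpace E] {Φ : X → Set E} (hΦ : LowerHemicontinuous Φ)
    (hne : ∀ x, (Φ x).Nonempty) {φ : X → E} (hφ : Continuous φ) :
    UpperSemicontinuous fun x => infDist (φ x) (Φ x) := by
  intro x r hr
  obtain ⟨z, hz, hzr⟩ := (infDist_lt_iff (hne x)).1 hr
  have hopen : IsOpen {q : E × E | dist q.1 q.2 < r} := isOpen_lt (by fun_prop) (by fun_prop)
  filter_upwards [lowerHemicontinuous_prod (lowerHemicontinuous_singleton_iff.2 hφ) hΦ x _
    ⟨hopen, (φ x, z), ⟨rfl, hz⟩, hzr⟩]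
  rintro y ⟨-, ⟨_, z'⟩, ⟨rfl, hz'⟩, hzr'⟩
  exact (infDist_lt_iff (hne y)).2 ⟨z', hz', hzr'⟩

theorem continuous_extend_of_dist_le {X E : Type*} [TopologicalSpace X] [PseudoMetricSpace E]
    {φ : X → E} (hφ : Continuous φ) {η : X → ℝ} (hη : Continuous η) {f : {x // η x ≠ 0} → E}
    (hf : Continuous f) {C r : ℝ} (hr : 0 < r)
    (hφf : ∀ x : {x // η x ≠ 0}, η x < r → dist (φ x) (f x) ≤ C * η x) :
    Continuous (extend Subtype.val f φ) := by
  set F := extend Subtype.val f φ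
  have hF : ∀ x : {x // η x ≠ 0}, F x = f x := Subtype.val_injective.extend_apply f φ
  have hF_zero : ∀ x, η x = 0 → F x = φ x := fun x hx =>
    extend_apply' _ _ _ fun ⟨y, hy⟩ => y.2 (hy ▸ hx)
  have hφF : ∀ x, η x < r → dist (φ x) (F x) ≤ C * η x := fun x hxr => by
    by_cases hx : η x = 0
    · rw [hF_zero x hx, dist_self, hx, mul_zero]
    · exact hF ⟨x, hx⟩ ▸ hφf ⟨x, hx⟩ hxr
  refine continuous_iff_continuousAt.2 fun x => ?_
  by_cases hx : η x = 0
  · have hsmall : ∀ᶠ y in 𝓝 x, η y < r := hη.continuousAt.eventually_lt_const (by rwa [hx])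
    have hCη : Tendsto (fun y => C * η y) (𝓝 x) (𝓝 0) :=
      (hη.const_mul C).tendsto' x 0 (by rw [hx, mul_zero])
    rw [ContinuousAt, hF_zero x hx]
    exact hφ.continuousAt.congr_dist
      (squeeze_zero' (.of_forall fun _ => dist_nonneg) (hsmall.mono hφF) hCη)
  · have hFon : ContinuousOn F {x | η x ≠ 0} :=
      continuousOn_iff_continuous_domRestrict.2 (hf.congr fun x => (hF x).symm)
    exact hFon.continuousAt ((isOpen_ne_fun hη continuous_const).mem_nhds hx)

variable {E : Type*} [NormedAddCommGroup E] [NormedSpace ℝ E] [CompleteSpace E]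

theorem ProximalContinuous.exists_selection_dist_le {Y : Type*} [TopologicalSpace Y]
    {Φ : Y → Set E} (hΦ : ProximalContinuous Φ) (hne : ∀ y, (Φ y).Nonempty)
    (hclosed : ∀ y, IsClosed (Φ y)) (hconvex : ∀ y, Convex ℝ (Φ y)) {φ : Y → E}
    (hφ : Continuous φ) {η : Y → ℝ} (hη : Continuous η) (hη_pos : ∀ y, 0 < η y)
    (hφη : ∀ y, min 1 (infDist (φ y) (Φ y)) ≤ η y) :
    ∃ f : Y → E, Continuous f ∧ (∀ y, f y ∈ Φ y) ∧
      ∀ y, η y ≤ 1 / 2 → dist (φ y) (f y) ≤ 6 * η y := by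
  obtain ⟨h, hh, hhΦ⟩ := hΦ.exists_selection hne hclosed hconvex
  -- Where `1 ≤ η y` the hypothesis says nothing about `Φ y`, but `h y` is a point of it.
  let M (y : Y) : ℝ := 2 * η y + max 0 (2 * η y - 1) * dist (φ y) (h y)
  have hM : Continuous M := by fun_prop
  have hφM : IsApproxSelection Φ M φ := by
    refine ⟨hφ, fun y => mem_thickening_iff.2 ?_⟩
    have hηy := hη_pos y
    rcases lt_or_ge (η y) 1 with hη1 | hη1
    · have hinf : infDist (φ y) (Φ y) ≤ η y := (min_le_iff.1 (hφη y)).resolve_left hη1.not_ge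
      have hM_ge : 2 * η y ≤ M y := le_add_of_nonneg_right (by positivity)
      exact (infDist_lt_iff (hne y)).1 (by linarith)
    · have hcoef : 1 ≤ max 0 (2 * η y - 1) := le_max_of_le_right (by linarith)
      have hdist := le_mul_of_one_le_left (dist_nonneg (x := φ y) (y := h y)) hcoef
      exact ⟨h y, hhΦ y, by linarith⟩
  obtain ⟨f, hf, hfΦ, hφf⟩ := hΦ.exists_selection_of_isApproxSelection hclosed hconvex hM hφM
  refine ⟨f, hf, hfΦ, fun y hy => (hφf y).trans_eq ?_⟩
  have hcoef : max 0 (2 * η y - 1) = 0 := max_eq_left (by linarith)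
  simp only [M, hcoef]
  ring

theorem exists_selection_eqOn_of_proximalContinuous {X : Type*} [TopologicalSpace X]
    [NormalSpace X] {Φ : X → Set E} (hne : ∀ x, (Φ x).Nonempty) {A : Set X} (hA : IsClosed A)
    (hclosed : ∀ x ∉ A, IsClosed (Φ x)) (hconvex : ∀ x ∉ A, Convex ℝ (Φ x))
    (hlsc : LowerHemicontinuous Φ) (hprox : ProximalContinuous fun x : (Aᶜ : Set X) => Φ x)
    {φ : X → E} (hφ : Continuous φ) (hφA : ∀ x ∈ A, φ x ∈ Φ x) :
    ∃ f : X → E, Continuous f ∧ (∀ x, f x ∈ Φ x) ∧ EqOn f φ A := by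
  obtain ⟨η, hη, hη_nonneg, hηA, hφη⟩ := exists_continuous_ge_of_upperSemicontinuous hA
    (upperSemicontinuous_const.inf
      (upperSemicontinuous_infDist_of_lowerHemicontinuous hlsc hne hφ))
    (fun x => min_le_left 1 _)
    (fun x hx => (min_le_right _ _).trans_eq (infDist_zero_of_mem (hφA x hx)))
  have hηA' : ∀ x : {x // η x ≠ 0}, (x : X) ∉ A := fun x hx => x.2 (hηA x hx)
  obtain ⟨f, hf, hfΦ, hφf⟩ := (hprox.comp (e := fun x : {x // η x ≠ 0} => ⟨x, hηA' x⟩)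
    (by fun_prop)).exists_selection_dist_le (fun x => hne x) (fun x => hclosed x (hηA' x))
    (fun x => hconvex x (hηA' x)) (hφ.comp continuous_subtype_val)
    (hη.comp continuous_subtype_val) (fun x => (hη_nonneg x).lt_of_ne' x.2) fun x => hφη x
  have hext : ∀ x, η x = 0 → extend Subtype.val f φ x = φ x := fun x hx =>
    extend_apply' _ _ _ fun ⟨y, hy⟩ => y.2 (hy ▸ hx)
  refine ⟨extend Subtype.val f φ, continuous_extend_of_dist_le hφ hη hf one_half_pos
    fun x hx => hφf x hx.le, fun x => ?_, fun x hx => hext x (hηA x hx)⟩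
  by_cases hx : η x = 0
  · rw [hext x hx]
    by_cases hxA : x ∈ A
    · exact hφA x hxA
    have hinf : infDist (φ x) (Φ x) ≤ 0 :=
      (min_le_iff.1 ((hφη x).trans_eq hx)).resolve_left one_pos.not_ge
    exact ((hclosed x hxA).mem_iff_infDist_zero (hne x)).2 (hinf.antisymm infDist_nonneg)
  · exact (Subtype.val_injective.extend_apply f φ ⟨x, hx⟩).symm ▸ hfΦ ⟨x, hx⟩

end SelectionsOffAClosedSet

theorem mainTheorem1_general {X : Type*} [TopologicalSpace X] (hX : CollectionwiseNormal X)
    {E : Type*} [NormedAddCommGroup E] [NormedSpace ℝ E] [CompleteSpace E]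
    {Φ : X → Set E} {A : Set X} (hA : IsClosed A) (hne : ∀ x ∉ A, (Φ x).Nonempty)
    (hclosed : ∀ x ∉ A, IsClosed (Φ x)) (hconvex : ∀ x ∉ A, Convex ℝ (Φ x))
    (hlsc : LowerHemicontinuous Φ) (hprox : ProximalContinuous fun x : (Aᶜ : Set X) => Φ x)
    {g : A → E} (hg : Continuous g) (hgsel : ∀ a : A, g a ∈ Φ a) :
    ∃ f : X → E, Continuous f ∧ (∀ x, f x ∈ Φ x) ∧ ∀ a : A, f a = g a := by
  have := hX.normalSpace
  have hne' : ∀ x, (Φ x).Nonempty := fun x =>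
    (em (x ∈ A)).elim (fun hx => ⟨_, hgsel ⟨x, hx⟩⟩) (hne x)
  obtain ⟨φ, hφ, hφg⟩ := hX.exists_extension hA hg
  have hφA : ∀ x ∈ A, φ x ∈ Φ x := fun x hx => hφg ⟨x, hx⟩ ▸ hgsel ⟨x, hx⟩
  obtain ⟨f, hf, hfΦ, hfφ⟩ :=
    exists_selection_eqOn_of_proximalContinuous hne' hA hclosed hconvex hlsc hprox hφ hφA
  exact ⟨f, hf, hfΦ, fun a => (hfφ a.2).trans (hφg a)⟩

theorem mainTheorem1 {X : Type*} [TopologicalSpace X] [T2Space X] (hX : CollectionwiseNormal X)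
    {E : Type*} [NormedAddCommGroup E] [NormedSpace ℝ E] [CompleteSpace E]
    (Φ : X → Set E) (hne : ∀ x, (Φ x).Nonempty) (hclosed : ∀ x, IsClosed (Φ x))
    (hconvex : ∀ x, Convex ℝ (Φ x)) (hlsc : LowerHemicontinuous Φ)
    (A : Set X) (hA : IsClosed A)
    (hprox : ProximalContinuous (fun x : (Aᶜ : Set X) => Φ x))
    (g : A → E) (hg : Continuous g) (hgsel : ∀ a : A, g a ∈ Φ a) :
    ∃ f : X → E, Continuous f ∧ (∀ x, f x ∈ Φ x) ∧ ∀ a : A, f a = g a :=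
  mainTheorem1_general hX hA (fun x _ => hne x) (fun x _ => hclosed x) (fun x _ => hconvex x)
    hlsc hprox hg hgsel
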